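/- **Theorem.** Let $\mathbb{F}_q$ be a finite field. In the quantum matrix-vector query model, an algorithm accesses an unknown matrix $M\in\mathbb{F}_q^{m\times n}$ only through the unitary $|x,y\rangle\mapsto|x,y+Mx\rangle$ ($x\in\mathbb{F}_q^n$, $y\in\mathbb{F}_q^m$), interleaved with arbitrary unitaries that do not depend on $M$ and act on these two registers and a finite-dimensional workspace, and it finally measures and accepts or rejects. Call $M$ full rank if $\operatorname{rank}M=\min\{m,n\}$, and let the nullity of $M$ be $\dim\ker M$ if $m\ge n$ and $\dim\ker M^{\top}$ if $m<n$, so that it equals $\min\{m,n\}-\operatorname{rank}M$. For every $\varepsilon\in[0,1/2)$ there is a constant $c>0$, depending only on $\varepsilon$ (not on $q,m,n$), such that for every finite field $\mathbb{F}_q$ and all $m,n$: 1. every quantum algorithm that decides with error probability at most $\varepsilon$ on each input whether a matrix $M\in\mathbb{F}_q^{m\times n}$ is full rank makes at least $c\min\{m,n\}$ matrix-vector queries; 2. the same lower bound $c\min\{m,n\}$ holds already for quantum algorithms that are only required to decide, with error probability at most $\varepsilon$, whether $M$ is full rank or has nullity $1$, under the promise that one of the two is the case. That is, the bounded-error quantum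 matrix-vector query complexity of both problems is $\Omega(\min\{m,n\})$. -/

import Mathlib

open scoped Matrix

/-- Labels of the computational basis of the registers of a matrix-vector query algorithm:
`|x, y, z⟩` with query register `x ∈ F^n`, response register `y ∈ F^m`, and a workspace of
dimension `w`. States are the functions `MVBasis F m n w → ℂ` of amplitudes. -/
abbrev MVBasis (F : Type*) (m n w : ℕ) : Type _ :=
  (Fin n → F) × (Fin m → F) × Fin w

/-- The matrix-vector oracle of `M ∈ F^{m × n}`: the unitary
`|x, y, z⟩ ↦ |x, y + M x, z⟩`. -/
def mvOracle {F : Type*} [Field F] [DecidableEq F] {m n : ℕ}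
    (M : Matrix (Fin m) (Fin n) F) (w : ℕ) :
    Matrix (MVBasis F m n w) (MVBasis F m n w) ℂ :=
  Matrix.of fun b a => if b = (a.1, a.2.1 + M *ᵥ a.1, a.2.2) then 1 else 0

/-- A quantum algorithm making `queries` matrix-vector queries. It starts in a computational
basis state, applies `gate 0`, then alternates oracle calls with the input-independent unitaries
`gate 1, …, gate queries`, and finally measures in the computational basis and accepts iff the
outcome lies in `accept`. (The unitaries `gate k` with `k > queries` are never applied.) -/
structure MVAlgorithm (F : Type*) [Field F] [Fintype F] [DecidableEq F] (m n : ℕ) where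
  queries : ℕ
  work : ℕ
  start : MVBasis F m n work
  gate : ℕ → Matrix.unitaryGroup (MVBasis F m n work) ℂ
  accept : Finset (MVBasis F m n work)

namespace MVAlgorithm

variable {F : Type*} [Field F] [Fintype F] [DecidableEq F] {m n : ℕ}

/-- The state of the algorithm on input `M` after `k` queries (and the unitary following them). -/
noncomputable def state (A : MVAlgorithm F m n) (M : Matrix (Fin m) (Fin n) F) :
    ℕ → MVBasis F m n A.work → ℂ
  | 0 => (A.gate 0).1 *ᵥ Pi.single A.start 1
  | k + 1 => (A.gate (k + 1)).1 *ᵥ (mvOracle M A.work *ᵥ A.state M k)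

/-- The probability that the algorithm accepts on input `M`. -/
noncomputable def acceptProb (A : MVAlgorithm F m n) (M : Matrix (Fin m) (Fin n) F) : ℝ :=
  ∑ b ∈ A.accept, ‖A.state M A.queries b‖ ^ 2

/-- The algorithm decides the promise problem "`yes` or `no`?" with error at most `ε`. -/
def Decides (A : MVAlgorithm F m n) (ε : ℝ) (yes no : Matrix (Fin m) (Fin n) F → Prop) : Prop :=
  (∀ M, yes M → 1 - ε ≤ A.acceptProb M) ∧ (∀ M, no M → A.acceptProb M ≤ ε)

end MVAlgorithm

/-- The `ε`-error quantum query complexity, in the matrix-vector model, of distinguishing the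
matrices satisfying `yes` from those satisfying `no` (no promise if `no` is the negation of `yes`):
the least number of queries of an algorithm that does so, and `⊤` if there is none. -/
noncomputable def mvQueryComplexity {F : Type*} [Field F] [Fintype F] [DecidableEq F] {m n : ℕ}
    (ε : ℝ) (yes no : Matrix (Fin m) (Fin n) F → Prop) : ℕ∞ :=
  ⨅ (A : MVAlgorithm F m n) (_ : A.Decides ε yes no), (A.queries : ℕ∞)

/-- An `m × n` matrix is full rank if its rank is `min m n`. -/
def IsFullRank {F : Type*} [Field F] {m n : ℕ} (M : Matrix (Fin m) (Fin n) F) : Prop :=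
  M.rank = min m n

/-- The nullity of an `m × n` matrix: the dimension of its null space if `m ≥ n`; a matrix with
`m < n` is replaced by its transpose. Thus full rank means nullity `0` in either case. -/
noncomputable def matNullity {F : Type*} [Field F] {m n : ℕ}
    (M : Matrix (Fin m) (Fin n) F) : ℕ :=
  if n ≤ m then Module.finrank F (LinearMap.ker M.mulVecLin)
  else Module.finrank F (LinearMap.ker Mᵀ.mulVecLin)

/-! ### Counting automorphisms of finite vector spaces. -/

section LinearCounting

open Module

variable {F V U D : Type*} [Field F] [AddCommGroup V] [Module F V] [AddCommGroup U] [Module F U]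
  [AddCommGroup D] [Module F D]

/-! This is the polynomial method. After `T` queries every amplitude is a combination of indicators
of `T` equations `M x = y`, so the acceptance probability uses `2T` of them. Average it over all `A
J B` with `A`, `B` invertible. Summing over `A` leaves only the condition that `J B X` and `Y` have
equal kernels; Möbius inversion over subspaces of the source of `X` reduces this to counting the `B`
with `B (X L) ≤ ker J`, a product of at most `2T` factors `q ^ dim (ker J) - q ^ i`. The average is
thus a polynomial of degree at most `2T` in `q ^ dim (ker J)`
(`exists_polynomial_sum_of_mem_matVecSpan`).

With `N = min m n`, rescaling and composing with an amplifying polynomial that depends only on `ε`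
gives a polynomial nearly in `[0, 1]` at `1, q, …, q ^ N` that drops from near `1` to near `0`
between `1` and `q`. The linear relation between the values at these points of a polynomial of
degree `< N` has rapidly decaying weights, dominated by the one at `1`, which forces degree at least
`N` (`le_natDegree_of_geometric_jump`). Only nullity `0` and `1` enter the jump, so both problems
are covered. -/

/-- Two linear maps with the same kernel differ by an automorphism of the codomain. -/
theorem LinearMap.exists_linearEquiv_comp_eq [FiniteDimensional F V] {X Y : D →ₗ[F] V}
    (h : LinearMap.ker X = LinearMap.ker Y) :
    ∃ g : V ≃ₗ[F] V, (g : V →ₗ[F] V) ∘ₗ X = Y := by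
  obtain ⟨g, hg⟩ := Submodule.exists_linearEquiv_restrict_eq
    (X.quotKerEquivRange.symm ≪≫ₗ Submodule.quotEquivOfEq _ _ h ≪≫ₗ Y.quotKerEquivRange)
  refine ⟨g, LinearMap.ext fun d => ?_⟩
  have := hg ⟨X d, d, rfl⟩
  have e : X.quotKerEquivRange.symm ⟨X d, d, rfl⟩ = Submodule.Quotient.mk d := by
    rw [LinearEquiv.symm_apply_eq]; rfl
  simp only [LinearEquiv.trans_apply, e] at this
  exact this.symm

-- The solutions `A` form a coset of the stabilizer of `Y`, or the empty set.
open Classical in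
theorem sum_linearEquiv_comp_eq [FiniteDimensional F U] [Fintype (U ≃ₗ[F] U)]
    (X Y : D →ₗ[F] U) :
    (∑ A : U ≃ₗ[F] U, if (A : U →ₗ[F] U) ∘ₗ X = Y then (1 : ℂ) else 0) =
      if LinearMap.ker X = LinearMap.ker Y then
        ∑ A : U ≃ₗ[F] U, if (A : U →ₗ[F] U) ∘ₗ Y = Y then (1 : ℂ) else 0 else 0 := by
  split_ifs with h
  · obtain ⟨g, hg⟩ := LinearMap.exists_linearEquiv_comp_eq h
    rw [← Equiv.sum_comp (Equiv.mulRight g)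
      (fun A : U ≃ₗ[F] U => if (A : U →ₗ[F] U) ∘ₗ X = Y then (1 : ℂ) else 0),
      ← Equiv.sum_comp (Equiv.refl (U ≃ₗ[F] U))]
    subst hg
    rfl
  · refine Finset.sum_eq_zero fun A _ => if_neg fun hA => h ?_
    rw [← hA, LinearEquiv.ker_comp]

variable [Fintype F]

open Classical in
/-- The number of automorphisms mapping a given subspace into `K` depends on `K` through
its dimension only, by an explicit product formula. -/
theorem exists_sum_linearEquiv_map_le [Finite V] [Fintype (V ≃ₗ[F] V)] (W : Submodule F V) :
    ∃ C : ℂ, ∀ K : Submodule F V,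
      (∑ B : V ≃ₗ[F] V, if W.map (B : V →ₗ[F] V) ≤ K then (1 : ℂ) else 0) =
        C * ∏ i ∈ Finset.range (finrank F W),
          ((Fintype.card F : ℂ) ^ finrank F K - (Fintype.card F : ℂ) ^ i) := by
  let b := finBasis F W
  let w : Fin (finrank F W) → V := fun i => b i
  have hw : LinearIndependent F w := b.linearIndependent.map' W.subtype W.ker_subtype
  let X := Fintype.linearCombination F w
  -- The constant is the order of the pointwise stabilizer of `W`; the product counts the
  -- independent families in `K` to which a basis of `W` can be sent.
  refine ⟨∑ B : V ≃ₗ[F] V, if (B : V →ₗ[F] V) ∘ₗ X = X then (1 : ℂ) else 0, fun K => ?_⟩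
  let _ : Fintype {s : Fin (finrank F W) → K // LinearIndependent F s} := Fintype.ofFinite _
  have hle : ∀ B : V ≃ₗ[F] V, W.map (B : V →ₗ[F] V) ≤ K ↔ ∀ i, B (w i) ∈ K := by
    intro B
    rw [Submodule.map_le_iff_le_comap]
    constructor
    · exact fun h i => h (b i).2
    · intro h x hx
      have : (⟨x, hx⟩ : W) ∈ (K.comap (B : V →ₗ[F] V)).comap W.subtype := by
        rw [← b.sum_repr ⟨x, hx⟩]
        exact Submodule.sum_mem _ fun i _ => Submodule.smul_mem _ _ (h i)
      exact this
  have hC : ∀ s : {s : Fin (finrank F W) → K // LinearIndependent F s},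
      (∑ B : V ≃ₗ[F] V, if (∀ i, B (w i) = s.1 i) then (1 : ℂ) else 0) =
        ∑ B : V ≃ₗ[F] V, if (B : V →ₗ[F] V) ∘ₗ X = X then (1 : ℂ) else 0 := by
    intro s
    have hs : LinearIndependent F (fun i => (s.1 i : V)) := s.2.map' K.subtype K.ker_subtype
    let Y := Fintype.linearCombination F (fun i => (s.1 i : V))
    have hX : LinearMap.ker X = ⊥ :=
      LinearMap.ker_eq_bot.2 (linearIndependent_iff_injective_fintypeLinearCombination.1 hw)
    have hY : LinearMap.ker Y = ⊥ :=
      LinearMap.ker_eq_bot.2 (linearIndependent_iff_injective_fintypeLinearCombination.1 hs)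
    obtain ⟨g, hg⟩ := LinearMap.exists_linearEquiv_comp_eq (hX.trans hY.symm)
    rw [← Equiv.sum_comp (Equiv.mulLeft g)
      (fun B : V ≃ₗ[F] V => if (∀ i, B (w i) = s.1 i) then (1 : ℂ) else 0)]
    refine Finset.sum_congr rfl fun B _ => if_congr ?_ rfl rfl
    have hXi : ∀ i, X (Pi.single i 1) = w i := fun i => by
      simp [X, Fintype.linearCombination_apply_single]
    have hgi : ∀ i, g (w i) = s.1 i := fun i => by
      have := LinearMap.congr_fun hg (Pi.single i 1)
      simpa [hXi, Y, Fintype.linearCombination_apply_single] using this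
    constructor
    · intro h
      refine LinearMap.pi_ext' fun i => LinearMap.ext_ring ?_
      have := (h i).trans (hgi i).symm
      simpa [hXi] using this
    · intro h i
      have := LinearMap.congr_fun h (Pi.single i 1)
      rw [← hgi]
      exact congrArg g (by simpa [hXi] using this)
  have hB : ∀ B : V ≃ₗ[F] V, (if W.map (B : V →ₗ[F] V) ≤ K then (1 : ℂ) else 0) =
      ∑ s : {s : Fin (finrank F W) → K // LinearIndependent F s},
        if (∀ i, B (w i) = s.1 i) then (1 : ℂ) else 0 := by
    intro B
    split_ifs with h
    · have h' := (hle B).1 h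
      have hli : LinearIndependent F (fun i => (⟨B (w i), h' i⟩ : K)) := by
        refine LinearIndependent.of_comp K.subtype ?_
        exact hw.map' (B : V →ₗ[F] V) (LinearEquiv.ker B)
      rw [Finset.sum_eq_single ⟨_, hli⟩]
      · simp
      · intro s _ hs
        refine if_neg fun hi => hs (Subtype.ext (funext fun i => Subtype.ext (hi i).symm))
      · simp
    · refine (Finset.sum_eq_zero fun s _ => if_neg fun hi => h ((hle B).2 fun i => ?_)).symm
      rw [hi i]; exact (s.1 i).2
  simp_rw [hB]
  rw [Finset.sum_comm, Finset.sum_congr rfl fun s _ => hC s, Finset.sum_const, nsmul_eq_mul,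
    mul_comm, Finset.card_univ, ← Nat.card_eq_fintype_card]
  congr 1
  by_cases hk : finrank F W ≤ finrank F K
  · rw [card_linearIndependent hk, Finset.prod_range, Nat.cast_prod]
    refine Finset.prod_congr rfl fun i _ => ?_
    rw [Nat.cast_sub (Nat.pow_le_pow_right Fintype.card_pos (i.2.le.trans hk))]
    push_cast; rfl
  -- If `dim K < dim W`, the factor `i = dim K` vanishes, as does the count.
  · rw [Finset.prod_eq_zero (Finset.mem_range.2 (not_le.1 hk)) (sub_self _)]
    have : IsEmpty {s : Fin (finrank F W) → K // LinearIndependent F s} :=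
      ⟨fun s => hk (by simpa using s.2.fintype_card_le_finrank)⟩
    simp

open Polynomial

open Classical in
/-- Möbius inversion over the subspaces of `D`: the number of automorphisms `B` for which
`J ∘ B ∘ X` has kernel `L` is polynomial in the size of the kernel of `J`. -/
theorem exists_polynomial_sum_ker_eq [Finite V] [Finite D] [Fintype (V ≃ₗ[F] V)]
    (X : D →ₗ[F] V) (L : Submodule F D) :
    ∃ p : ℂ[X], p.natDegree ≤ finrank F D ∧ ∀ J : V →ₗ[F] U,
      (∑ B : V ≃ₗ[F] V, if LinearMap.ker (J ∘ₗ (B : V →ₗ[F] V) ∘ₗ X) = L then (1 : ℂ) else 0) =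
        p.eval ((Fintype.card F : ℂ) ^ finrank F (LinearMap.ker J)) := by
  let _ : Fintype (Submodule F D) := Fintype.ofFinite _
  -- Descending induction: count the `B` with `L ≤ ker (J B X)`, that is, `B (X L) ≤ ker J`, and
  -- subtract those whose kernel is strictly larger.
  induction L using WellFoundedGT.induction with
  | ind L ih =>
    choose! p hdeg hp using ih
    obtain ⟨C, hC⟩ := exists_sum_linearEquiv_map_le (L.map X)
    refine ⟨Polynomial.C C * ∏ i ∈ Finset.range (finrank F (L.map X)),
      (Polynomial.X - Polynomial.C ((Fintype.card F : ℂ) ^ i)) -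
      ∑ L' ∈ Finset.univ.filter (L < ·), p L', ?_, fun J => ?_⟩
    · refine (natDegree_sub_le _ _).trans (max_le ?_ ?_)
      · refine (natDegree_C_mul_le _ _).trans ?_
        rw [natDegree_prod_of_monic _ _ fun i _ => monic_X_sub_C _]
        simp only [natDegree_X_sub_C, Finset.sum_const, Finset.card_range, smul_eq_mul, mul_one]
        exact (Submodule.finrank_map_le X L).trans (Submodule.finrank_le L)
      · exact natDegree_sum_le_of_forall_le _ _ fun L' hL' => hdeg L' (Finset.mem_filter.1 hL').2
    · rw [eval_sub, eval_mul, eval_C, eval_prod, eval_finsetSum]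
      simp only [eval_sub, eval_X, eval_C]
      rw [← hC (LinearMap.ker J), eq_sub_iff_add_eq,
        Finset.sum_congr rfl fun L' hL' => (hp L' (Finset.mem_filter.1 hL').2 J).symm,
        Finset.sum_comm, ← Finset.sum_add_distrib]
      refine Finset.sum_congr rfl fun B _ => ?_
      have hmap : (L.map X).map (B : V →ₗ[F] V) ≤ LinearMap.ker J ↔
          L ≤ LinearMap.ker (J ∘ₗ (B : V →ₗ[F] V) ∘ₗ X) := by
        rw [← Submodule.map_comp, Submodule.map_le_iff_le_comap]
        rfl
      rw [if_congr hmap rfl rfl, Finset.sum_ite_eq]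
      simp only [Finset.mem_filter, Finset.mem_univ, true_and]
      rcases eq_or_ne (LinearMap.ker (J ∘ₗ (B : V →ₗ[F] V) ∘ₗ X)) L with h | h
      · simp [h]
      · simp [h, lt_iff_le_and_ne, h.symm]

open Classical in
/-- Averaging an interpolation condition over the two automorphism groups yields a polynomial
in the size of the kernel. -/
theorem exists_polynomial_sum_sum_comp_eq [Finite V] [Finite D] [Finite U]
    [Fintype (V ≃ₗ[F] V)] [Fintype (U ≃ₗ[F] U)] (X : D →ₗ[F] V) (Y : D →ₗ[F] U) :
    ∃ p : ℂ[X], p.natDegree ≤ finrank F D ∧ ∀ J : V →ₗ[F] U,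
      (∑ B : V ≃ₗ[F] V, ∑ A : U ≃ₗ[F] U,
        if (A : U →ₗ[F] U) ∘ₗ J ∘ₗ (B : V →ₗ[F] V) ∘ₗ X = Y then (1 : ℂ) else 0) =
        p.eval ((Fintype.card F : ℂ) ^ finrank F (LinearMap.ker J)) := by
  obtain ⟨p, hdeg, hp⟩ := exists_polynomial_sum_ker_eq (U := U) X (LinearMap.ker Y)
  refine ⟨p * Polynomial.C (∑ A : U ≃ₗ[F] U, if (A : U →ₗ[F] U) ∘ₗ Y = Y then (1 : ℂ) else 0),
    (natDegree_mul_C_le _ _).trans hdeg, fun J => ?_⟩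
  rw [eval_mul, eval_C, ← hp J, Finset.sum_mul]
  refine Finset.sum_congr rfl fun B _ => ?_
  rw [sum_linearEquiv_comp_eq, ite_mul, one_mul, zero_mul]

end LinearCounting

/-! ### Polynomials at the points of a geometric progression. -/

section GeometricPoints

open Polynomial Finset

/-- The polynomial `∏_{k < N} (1 - x ^ k T)`. -/
noncomputable def geomAnnihilator (x : ℝ) (N : ℕ) : ℝ[X] :=
  ∏ k ∈ range N, (1 - C (x ^ k) * X)

theorem natDegree_geomAnnihilator_le (x : ℝ) (N : ℕ) : (geomAnnihilator x N).natDegree ≤ N := by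
  refine (natDegree_prod_le _ _).trans ?_
  refine (sum_le_card_nsmul _ _ 1 fun k _ => ?_).trans (by simp)
  refine (natDegree_sub_le _ _).trans (max_le (by simp) ?_)
  exact (natDegree_C_mul_le _ _).trans natDegree_X_le

theorem geomAnnihilator_eval_inv_pow {x : ℝ} (hx : x ≠ 0) {N k : ℕ} (hk : k < N) :
    (geomAnnihilator x N).eval (x⁻¹ ^ k) = 0 := by
  rw [geomAnnihilator, eval_prod]
  refine prod_eq_zero (mem_range.2 hk) ?_
  simp [hx]

theorem geomAnnihilator_succ (x : ℝ) (N : ℕ) :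
    geomAnnihilator x (N + 1) = (1 - X) * (geomAnnihilator x N).comp (C x * X) := by
  rw [geomAnnihilator, prod_range_succ', mul_comm, geomAnnihilator, Polynomial.prod_comp]
  congr 1
  · simp
  · refine prod_congr rfl fun k _ => ?_
    simp [pow_succ, mul_assoc]

theorem coeff_zero_geomAnnihilator (x : ℝ) (N : ℕ) : (geomAnnihilator x N).coeff 0 = 1 := by
  rw [coeff_zero_eq_eval_zero, geomAnnihilator, eval_prod]
  simp

theorem coeff_succ_geomAnnihilator_succ (x : ℝ) (N j : ℕ) :
    (geomAnnihilator x (N + 1)).coeff (j + 1) =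
      x ^ (j + 1) * (geomAnnihilator x N).coeff (j + 1) -
        x ^ j * (geomAnnihilator x N).coeff j := by
  rw [geomAnnihilator_succ, sub_mul, one_mul, coeff_sub, coeff_X_mul, comp_C_mul_X_coeff,
    comp_C_mul_X_coeff]
  ring

/-- The coefficient recursion in `N` preserves the bound `b` as soon as `hab` holds. The constants
`2`, `4 / 3`, `8 / 21` below are the successive cases of equality in `hab`. -/
theorem abs_coeff_succ_geomAnnihilator_le {x : ℝ} (hx0 : 0 ≤ x) (hx : x ≤ 1 / 2) {j : ℕ}
    {a b : ℝ} (ha : ∀ N, |(geomAnnihilator x N).coeff j| ≤ a) (hb : 0 ≤ b)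
    (hab : (1 / 2) ^ (j + 1) * b + (1 / 2) ^ j * a ≤ b) (N : ℕ) :
    |(geomAnnihilator x N).coeff (j + 1)| ≤ b := by
  have ha0 : 0 ≤ a := (abs_nonneg _).trans (ha 0)
  induction N with
  | zero => simpa [geomAnnihilator, coeff_one] using hb
  | succ N ih =>
    rw [coeff_succ_geomAnnihilator_succ]
    refine (abs_sub _ _).trans ?_
    rw [abs_mul, abs_mul, abs_of_nonneg (pow_nonneg hx0 _), abs_of_nonneg (pow_nonneg hx0 _)]
    refine le_trans ?_ hab
    gcongr
    exact ha N

theorem abs_coeff_one_geomAnnihilator_le {x : ℝ} (hx0 : 0 ≤ x) (hx : x ≤ 1 / 2) (N : ℕ) :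
    |(geomAnnihilator x N).coeff 1| ≤ 2 :=
  abs_coeff_succ_geomAnnihilator_le hx0 hx (a := 1)
    (fun N => by simp [coeff_zero_geomAnnihilator]) (by norm_num) (by norm_num) N

theorem abs_coeff_two_geomAnnihilator_le {x : ℝ} (hx0 : 0 ≤ x) (hx : x ≤ 1 / 2) (N : ℕ) :
    |(geomAnnihilator x N).coeff 2| ≤ 4 / 3 :=
  abs_coeff_succ_geomAnnihilator_le hx0 hx
    (abs_coeff_one_geomAnnihilator_le hx0 hx) (by norm_num) (by norm_num) N

theorem abs_coeff_add_three_geomAnnihilator_le {x : ℝ} (hx0 : 0 ≤ x) (hx : x ≤ 1 / 2)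
    (j N : ℕ) : |(geomAnnihilator x N).coeff (j + 3)| ≤ 8 / 21 * (1 / 4) ^ j := by
  induction j generalizing N with
  | zero =>
    exact abs_coeff_succ_geomAnnihilator_le hx0 hx
      (abs_coeff_two_geomAnnihilator_le hx0 hx) (by norm_num) (by norm_num) N
  | succ j ih =>
    refine abs_coeff_succ_geomAnnihilator_le hx0 hx ih (by positivity) ?_ N
    have h1 : ((1 : ℝ) / 2) ^ j ≤ 1 := pow_le_one₀ (by norm_num) (by norm_num)
    have h2 : (0 : ℝ) < (1 / 4) ^ j := by positivity
    have e1 : ((1 : ℝ) / 2) ^ (j + 1 + 2 + 1) = (1 / 2) ^ j * (1 / 16) := by ring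
    have e2 : ((1 : ℝ) / 2) ^ (j + 1 + 2) = (1 / 2) ^ j * (1 / 8) := by ring
    rw [e1, e2, pow_succ (1 / 4 : ℝ)]
    nlinarith [mul_le_mul_of_nonneg_right h1 h2.le]

theorem coeff_one_geomAnnihilator_nonpos {x : ℝ} (hx0 : 0 ≤ x) (N : ℕ) :
    (geomAnnihilator x N).coeff 1 ≤ 0 := by
  induction N with
  | zero => simp [geomAnnihilator, coeff_one]
  | succ N ih =>
    rw [coeff_succ_geomAnnihilator_succ, coeff_zero_geomAnnihilator]
    have := mul_nonpos_of_nonneg_of_nonpos hx0 ih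
    simp only [zero_add, pow_one, pow_zero]
    linarith

theorem coeff_two_geomAnnihilator_nonneg {x : ℝ} (hx0 : 0 ≤ x) (N : ℕ) :
    0 ≤ (geomAnnihilator x N).coeff 2 := by
  induction N with
  | zero => simp [geomAnnihilator, coeff_one]
  | succ N ih =>
    rw [coeff_succ_geomAnnihilator_succ]
    have h1 := mul_nonpos_of_nonneg_of_nonpos hx0 (coeff_one_geomAnnihilator_nonpos hx0 N)
    have h2 := mul_nonneg (pow_nonneg hx0 2) ih
    simp only [pow_one, Nat.reduceAdd]
    linarith

/-- The coefficients of `geomAnnihilator` are the weights of a linear relation between the values of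
any polynomial of degree `< N` at the points `1, q, …, q ^ N`. -/
theorem sum_coeff_geomAnnihilator_mul_eval {q : ℝ} (hq : q ≠ 0) {N : ℕ} {h : ℂ[X]}
    (hdeg : h.natDegree < N) :
    ∑ j ∈ range (N + 1), ((geomAnnihilator q⁻¹ N).coeff j : ℂ) * h.eval ((q : ℂ) ^ j) = 0 := by
  simp_rw [eval_eq_sum_range, mul_sum]
  rw [sum_comm]
  refine sum_eq_zero fun i hi => ?_
  have hi' : i < N := (Nat.lt_succ_iff.1 (mem_range.1 hi)).trans_lt hdeg
  -- The monomial of degree `i` contributes the annihilator's value at `q ^ i`, a root because `i <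
  -- N`.
  have := geomAnnihilator_eval_inv_pow (inv_ne_zero hq) hi'
  rw [inv_inv, eval_eq_sum_range' (Nat.lt_succ_of_le (natDegree_geomAnnihilator_le _ _))] at this
  have h2 := congrArg (fun t : ℝ => h.coeff i * (t : ℂ)) this
  simp only [Complex.ofReal_zero, mul_zero] at h2
  rw [← h2]
  push_cast
  rw [mul_sum]
  refine sum_congr rfl fun j _ => ?_
  rw [pow_right_comm]
  ring

/-- A polynomial taking values close to `[0, 1]` at `1, q, …, q ^ N`, close to `1` at `1` and close
to `0` at `q`, has degree at least `N`. -/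
theorem le_natDegree_of_geometric_jump {q : ℝ} (hq : 2 ≤ q) {N : ℕ} (hN : 1 ≤ N) {h : ℂ[X]}
    {v : ℕ → ℝ} (hv : ∀ j ≤ N, h.eval ((q : ℂ) ^ j) = v j)
    (hlo : ∀ j ≤ N, -(1 / 20) ≤ v j) (hhi : ∀ j ≤ N, v j ≤ 21 / 20)
    (h0 : 19 / 20 ≤ v 0) (h1 : v 1 ≤ 1 / 20) : N ≤ h.natDegree := by
  by_contra! hdeg
  have hq0 : 0 < q := by linarith
  have hx0 : 0 ≤ q⁻¹ := inv_nonneg.2 hq0.le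
  have hx : q⁻¹ ≤ 1 / 2 := by rw [one_div]; exact inv_anti₀ two_pos hq
  have key := sum_coeff_geomAnnihilator_mul_eval hq0.ne' hdeg
  rw [sum_congr rfl fun j hj => by rw [hv j (Nat.lt_succ_iff.1 (mem_range.1 hj))]] at key
  have key' : ∑ j ∈ range (N + 1), (geomAnnihilator q⁻¹ N).coeff j * v j = 0 := by
    exact_mod_cast key
  set w := (geomAnnihilator q⁻¹ N).coeff with hw
  -- Extension by zero lets three terms be split off even when `N < 3`.
  set u : ℕ → ℝ := fun j => if j ≤ N then v j else 0 with hu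
  have hulo : ∀ j, -(1 / 20) ≤ u j := fun j => by
    simp only [hu]; split_ifs with hj
    exacts [hlo j hj, by norm_num]
  have huhi : ∀ j, u j ≤ 21 / 20 := fun j => by
    simp only [hu]; split_ifs with hj
    exacts [hhi j hj, by norm_num]
  have habs : ∀ j, |u j| ≤ 21 / 20 := fun j => abs_le.2 ⟨by linarith [hulo j], huhi j⟩
  have key2 : ∑ j ∈ range (N + 3), w j * u j = 0 := by
    rw [← key']
    refine (sum_subset_zero_on_sdiff (range_mono (by omega)) ?_ ?_).symm
    · intro j hj
      have : ¬ j ≤ N := by simp at hj; omega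
      simp [hu, this]
    · intro j hj
      have : j ≤ N := by simp at hj; omega
      simp [hu, this]
  rw [sum_range_succ', sum_range_succ', sum_range_succ'] at key2
  simp only [zero_add, add_assoc, Nat.reduceAdd] at key2
  have hu0 : u 0 = v 0 := if_pos (Nat.zero_le N)
  have hu1 : u 1 = v 1 := if_pos hN
  have hw0 : w 0 = 1 := coeff_zero_geomAnnihilator _ _
  have hw1 := abs_le.1 (abs_coeff_one_geomAnnihilator_le hx0 hx N)
  have hw1' := coeff_one_geomAnnihilator_nonpos hx0 N
  have hw2 := abs_le.1 (abs_coeff_two_geomAnnihilator_le hx0 hx N)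
  have hw2' := coeff_two_geomAnnihilator_nonneg hx0 N
  rw [← hw] at hw1 hw1' hw2 hw2'
  have htail : -(8 / 15) ≤ ∑ j ∈ range N, w (j + 3) * u (j + 3) := by
    have hgeom : ∑ j ∈ range N, (1 / 4 : ℝ) ^ j ≤ 4 / 3 := by
      rw [geom_sum_eq (by norm_num), div_le_iff_of_neg (by norm_num)]
      have : (0 : ℝ) ≤ (1 / 4) ^ N := by positivity
      linarith
    -- Here `2 / 5 = 8 / 21 * (21 / 20)`.
    have hterm : ∀ j ∈ range N, -(2 / 5 * (1 / 4 : ℝ) ^ j) ≤ w (j + 3) * u (j + 3) := by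
      intro j _
      refine (abs_le.1 ?_).1
      rw [abs_mul]
      refine (mul_le_mul (abs_coeff_add_three_geomAnnihilator_le hx0 hx j N) (habs _)
        (abs_nonneg _) (by positivity)).trans (le_of_eq (by ring))
    refine le_trans ?_ (sum_le_sum hterm)
    rw [sum_neg_distrib, ← mul_sum]
    linarith
  rw [hu0, hu1, hw0] at key2
  have hv1 := hlo 1 hN
  have hu2 := hulo 2
  -- The vanishing sum would be at least `19/20 - 1/10 - 1/15 - 8/15 = 1/4`.
  nlinarith [mul_nonneg hw2' (by linarith : 0 ≤ u 2 + 1 / 20),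
    mul_nonneg (neg_nonneg.2 hw1') (by linarith : 0 ≤ v 1 + 1 / 20),
    mul_nonneg (neg_nonneg.2 hw1') (by linarith : 0 ≤ 1 / 20 - v 1)]

end GeometricPoints

/-! ### Acceptance probabilities as combinations of indicators. -/

section MatVecSpan

open Matrix

variable {F : Type*} [Field F] [DecidableEq F] {m n : ℕ}

/-- The indicator function of the matrices sending `x i` to `y i` for all `i`. -/
noncomputable def matVecIndicator {d : ℕ} (x : Fin d → Fin n → F) (y : Fin d → Fin m → F)
    (M : Matrix (Fin m) (Fin n) F) : ℂ :=
  if ∀ i, M *ᵥ x i = y i then 1 else 0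

variable (F m n) in
/-- The functions of a matrix that are linear combinations of indicators of `d` matrix-vector
products. -/
noncomputable def matVecSpan (d : ℕ) : Submodule ℂ (Matrix (Fin m) (Fin n) F → ℂ) :=
  Submodule.span ℂ (Set.range fun p : (Fin d → Fin n → F) × (Fin d → Fin m → F) =>
    matVecIndicator p.1 p.2)

theorem matVecIndicator_mem {d : ℕ} (x : Fin d → Fin n → F) (y : Fin d → Fin m → F) :
    matVecIndicator x y ∈ matVecSpan F m n d :=
  Submodule.subset_span ⟨(x, y), rfl⟩

theorem matVecIndicator_append {d e : ℕ} (x : Fin d → Fin n → F) (y : Fin d → Fin m → F)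
    (x' : Fin e → Fin n → F) (y' : Fin e → Fin m → F) :
    matVecIndicator (Fin.append x x') (Fin.append y y') =
      matVecIndicator x y * matVecIndicator x' y' := by
  funext M
  have : (∀ i, M *ᵥ Fin.append x x' i = Fin.append y y' i) ↔
      (∀ i, M *ᵥ x i = y i) ∧ ∀ i, M *ᵥ x' i = y' i := by
    constructor
    · intro h
      exact ⟨fun i => by simpa using h (Fin.castAdd e i), fun i => by simpa using h (Fin.natAdd d i)⟩
    · rintro ⟨h, h'⟩ i
      refine Fin.addCases (fun i => ?_) (fun i => ?_) i
      · simpa using h i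
      · simpa using h' i
  simp only [matVecIndicator, this, Pi.mul_apply, ite_and, mul_ite, mul_one, mul_zero]
  split_ifs <;> rfl

theorem mul_mem_matVecSpan {d e : ℕ} {f g : Matrix (Fin m) (Fin n) F → ℂ}
    (hf : f ∈ matVecSpan F m n d) (hg : g ∈ matVecSpan F m n e) :
    f * g ∈ matVecSpan F m n (d + e) := by
  have h := Submodule.mul_mem_mul hf hg
  rw [matVecSpan, matVecSpan, Submodule.span_mul_span] at h
  refine Submodule.span_mono ?_ h
  rintro _ ⟨_, ⟨p, rfl⟩, _, ⟨p', rfl⟩, rfl⟩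
  exact ⟨(Fin.append p.1 p'.1, Fin.append p.2 p'.2), matVecIndicator_append _ _ _ _⟩

theorem star_mem_matVecSpan {d : ℕ} {f : Matrix (Fin m) (Fin n) F → ℂ}
    (hf : f ∈ matVecSpan F m n d) : star f ∈ matVecSpan F m n d := by
  induction hf using Submodule.span_induction with
  | mem f hf =>
    obtain ⟨p, rfl⟩ := hf
    convert matVecIndicator_mem p.1 p.2 using 1
    funext M
    simp only [matVecIndicator, Pi.star_apply]
    split_ifs <;> simp
  | zero => simp
  | add f g _ _ hf hg => rw [star_add]; exact add_mem hf hg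
  | smul c f _ hf => rw [star_smul]; exact Submodule.smul_mem _ _ hf

theorem const_mem_matVecSpan_zero (c : ℂ) :
    (fun _ => c) ∈ matVecSpan F m n 0 := by
  have := Submodule.smul_mem _ c (matVecIndicator_mem (F := F) (m := m) (n := n) (d := 0)
    Fin.elim0 Fin.elim0)
  convert this using 1
  funext M
  simp [matVecIndicator]

theorem mvOracle_mem_matVecSpan {w : ℕ} (b a : MVBasis F m n w) :
    (fun M => mvOracle M w b a) ∈ matVecSpan F m n 1 := by
  by_cases h : b.1 = a.1 ∧ b.2.2 = a.2.2
  · convert matVecIndicator_mem (fun _ : Fin 1 => a.1) (fun _ => b.2.1 - a.2.1) using 1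
    funext M
    simp only [mvOracle, of_apply, matVecIndicator, forall_const]
    refine if_congr ?_ rfl rfl
    rw [Prod.ext_iff, Prod.ext_iff, eq_sub_iff_add_eq']
    simp [h, eq_comm]
  · convert Submodule.zero_mem (matVecSpan F m n 1) using 1
    funext M
    simp only [mvOracle, of_apply, Pi.zero_apply]
    refine if_neg fun hb => h ?_
    rw [hb]
    exact ⟨rfl, rfl⟩

variable [Fintype F]

/-- Each oracle entry is zero or the indicator of one equation `M x = y`, and gates do not depend on
`M`, so a query raises the degree by one. -/
theorem MVAlgorithm.state_mem_matVecSpan (A : MVAlgorithm F m n) (k : ℕ)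
    (b : MVBasis F m n A.work) : (fun M => A.state M k b) ∈ matVecSpan F m n k := by
  induction k generalizing b with
  | zero => exact const_mem_matVecSpan_zero _
  | succ k ih =>
    have : (fun M => A.state M (k + 1) b) = ∑ a, (A.gate (k + 1)).1 b a •
        ∑ c, (fun M => mvOracle M A.work a c) * fun M => A.state M k c := by
      funext M
      simp [MVAlgorithm.state, mulVec, dotProduct, Finset.sum_apply]
    rw [this]
    refine Submodule.sum_mem _ fun a _ => Submodule.smul_mem _ _ (Submodule.sum_mem _ fun c _ => ?_)
    rw [add_comm]
    exact mul_mem_matVecSpan (mvOracle_mem_matVecSpan a c) (ih c)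

theorem MVAlgorithm.acceptProb_mem_matVecSpan (A : MVAlgorithm F m n) :
    (fun M => (A.acceptProb M : ℂ)) ∈ matVecSpan F m n (A.queries + A.queries) := by
  have : (fun M => (A.acceptProb M : ℂ)) = ∑ b ∈ A.accept,
      star (fun M => A.state M A.queries b) * fun M => A.state M A.queries b := by
    funext M
    simp [MVAlgorithm.acceptProb, Finset.sum_apply, ← Complex.conj_mul']
  rw [this]
  exact Submodule.sum_mem _ fun b _ => mul_mem_matVecSpan
    (star_mem_matVecSpan (A.state_mem_matVecSpan _ b)) (A.state_mem_matVecSpan _ b)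

theorem sum_norm_sq_mulVec_of_unitary {ι : Type*} [Fintype ι] [DecidableEq ι]
    (U : unitaryGroup ι ℂ) (v : ι → ℂ) : ∑ i, ‖(U.1 *ᵥ v) i‖ ^ 2 = ∑ i, ‖v i‖ ^ 2 := by
  have key : ∀ u : ι → ℂ, ((∑ i, ‖u i‖ ^ 2 : ℝ) : ℂ) = star u ⬝ᵥ u := fun u => by
    simp [dotProduct, ← Complex.conj_mul']
  apply Complex.ofReal_injective
  rw [key, key, star_mulVec, dotProduct_mulVec, vecMul_vecMul, ← star_eq_conjTranspose,
    UnitaryGroup.star_mul_self, vecMul_one]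

theorem mvOracle_mulVec_apply (M : Matrix (Fin m) (Fin n) F) {w : ℕ} (v : MVBasis F m n w → ℂ)
    (b : MVBasis F m n w) :
    (mvOracle M w *ᵥ v) b = v (b.1, b.2.1 - M *ᵥ b.1, b.2.2) := by
  rw [mulVec, dotProduct, Finset.sum_eq_single (b.1, b.2.1 - M *ᵥ b.1, b.2.2)]
  · simp [mvOracle]
  · intro a _ ha
    rw [mvOracle, of_apply, if_neg, zero_mul]
    rintro rfl
    exact ha (by simp)
  · simp

theorem sum_norm_sq_mvOracle_mulVec (M : Matrix (Fin m) (Fin n) F) {w : ℕ}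
    (v : MVBasis F m n w → ℂ) : ∑ b, ‖(mvOracle M w *ᵥ v) b‖ ^ 2 = ∑ b, ‖v b‖ ^ 2 := by
  simp_rw [mvOracle_mulVec_apply]
  let e : MVBasis F m n w ≃ MVBasis F m n w :=
    { toFun := fun b => (b.1, b.2.1 - M *ᵥ b.1, b.2.2)
      invFun := fun b => (b.1, b.2.1 + M *ᵥ b.1, b.2.2)
      left_inv := fun b => by simp
      right_inv := fun b => by simp }
  exact e.sum_comp fun b => ‖v b‖ ^ 2

theorem MVAlgorithm.sum_norm_sq_state (A : MVAlgorithm F m n) (M : Matrix (Fin m) (Fin n) F)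
    (k : ℕ) : ∑ b, ‖A.state M k b‖ ^ 2 = 1 := by
  induction k with
  | zero =>
    rw [MVAlgorithm.state, sum_norm_sq_mulVec_of_unitary]
    rw [Finset.sum_eq_single A.start (fun b _ hb => by simp [hb]) (by simp)]
    simp
  | succ k ih => rw [MVAlgorithm.state, sum_norm_sq_mulVec_of_unitary,
      sum_norm_sq_mvOracle_mulVec, ih]

theorem MVAlgorithm.acceptProb_nonneg (A : MVAlgorithm F m n) (M : Matrix (Fin m) (Fin n) F) :
    0 ≤ A.acceptProb M :=
  Finset.sum_nonneg fun _ _ => by positivity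

/-- This is what controls the matrices of nullity at least `2`, on which a promise algorithm is
otherwise unconstrained. -/
theorem MVAlgorithm.acceptProb_le_one (A : MVAlgorithm F m n) (M : Matrix (Fin m) (Fin n) F) :
    A.acceptProb M ≤ 1 := by
  rw [← A.sum_norm_sq_state M A.queries]
  exact Finset.sum_le_sum_of_subset_of_nonneg (Finset.subset_univ _) fun _ _ _ => by positivity

end MatVecSpan

/-! ### Averaging over matrices of fixed rank, and the lower bound. -/

section RankLowerBound

open Matrix Module Polynomial

variable {F : Type*} [Field F] {m n : ℕ}

theorem exists_linearMap_finrank_range_eq (F : Type*) [Field F] {m n r : ℕ} (hm : r ≤ m) (hn : r ≤ n) :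
    ∃ J : (Fin n → F) →ₗ[F] (Fin m → F), finrank F (LinearMap.range J) = r := by
  have hp := LinearMap.funLeft_surjective_of_injective F F _ (Fin.castLE_injective hn)
  have hp' := LinearMap.funLeft_surjective_of_injective F F _ (Fin.castLE_injective hm)
  obtain ⟨s, hs⟩ := LinearMap.exists_rightInverse_of_surjective _ (LinearMap.range_eq_top.2 hp')
  have hsi : Function.Injective s :=
    Function.LeftInverse.injective (g := LinearMap.funLeft F F (Fin.castLE hm))
      (LinearMap.congr_fun hs)
  refine ⟨s ∘ₗ LinearMap.funLeft F F (Fin.castLE hn), ?_⟩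
  rw [LinearMap.range_comp_of_range_eq_top _ (LinearMap.range_eq_top.2 hp),
    LinearMap.finrank_range_of_inj hsi]
  simp

theorem rank_toMatrix'_comp (J : (Fin n → F) →ₗ[F] (Fin m → F))
    (B : (Fin n → F) ≃ₗ[F] (Fin n → F)) (A : (Fin m → F) ≃ₗ[F] (Fin m → F)) :
    (LinearMap.toMatrix' (A.toLinearMap ∘ₗ J ∘ₗ B.toLinearMap)).rank =
      finrank F (LinearMap.range J) := by
  rw [Matrix.rank, ← Matrix.toLin'_apply', Matrix.toLin'_toMatrix', LinearMap.range_comp,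
    LinearMap.range_comp_of_range_eq_top _ (LinearEquiv.range B), LinearEquiv.finrank_map_eq]

theorem matNullity_add_rank (M : Matrix (Fin m) (Fin n) F) :
    matNullity M + M.rank = min m n := by
  rw [matNullity]
  split_ifs with h
  · have := M.mulVecLin.finrank_range_add_finrank_ker
    rw [finrank_fin_fun, ← Matrix.rank] at this
    omega
  · have := Mᵀ.mulVecLin.finrank_range_add_finrank_ker
    rw [finrank_fin_fun, ← Matrix.rank, Matrix.rank_transpose] at this
    omega

variable [Fintype F] [DecidableEq F]

/-- Averages of functions in `matVecSpan F m n d` over all matrices equivalent to a given one are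
polynomials of degree at most `d` in the number of elements of the kernel. -/
theorem exists_polynomial_sum_of_mem_matVecSpan
    [Fintype ((Fin n → F) ≃ₗ[F] (Fin n → F))] [Fintype ((Fin m → F) ≃ₗ[F] (Fin m → F))]
    {d : ℕ} {f : Matrix (Fin m) (Fin n) F → ℂ} (hf : f ∈ matVecSpan F m n d) :
    ∃ p : ℂ[X], p.natDegree ≤ d ∧ ∀ J : (Fin n → F) →ₗ[F] (Fin m → F),
      (∑ B : (Fin n → F) ≃ₗ[F] (Fin n → F), ∑ A : (Fin m → F) ≃ₗ[F] (Fin m → F),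
        f (LinearMap.toMatrix' (A.toLinearMap ∘ₗ J ∘ₗ B.toLinearMap))) =
        p.eval ((Fintype.card F : ℂ) ^ finrank F (LinearMap.ker J)) := by
  induction hf using Submodule.span_induction with
  | mem f hf =>
    obtain ⟨⟨x, y⟩, rfl⟩ := hf
    obtain ⟨p, hdeg, hp⟩ := exists_polynomial_sum_sum_comp_eq
      (Fintype.linearCombination F x) (Fintype.linearCombination F y)
    refine ⟨p, by simpa using hdeg, fun J => ?_⟩
    rw [← hp J]
    refine Finset.sum_congr rfl fun B _ => Finset.sum_congr rfl fun A _ => ?_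
    have hiff : (∀ i, LinearMap.toMatrix' (A.toLinearMap ∘ₗ J ∘ₗ B.toLinearMap) *ᵥ x i = y i) ↔
        A.toLinearMap ∘ₗ J ∘ₗ B.toLinearMap ∘ₗ Fintype.linearCombination F x =
          Fintype.linearCombination F y := by
      simp only [LinearMap.toMatrix'_mulVec]
      constructor
      · intro h
        refine LinearMap.pi_ext' fun i => LinearMap.ext_ring ?_
        simpa [Fintype.linearCombination_apply_single] using h i
      · intro h i
        simpa [Fintype.linearCombination_apply_single] using LinearMap.congr_fun h (Pi.single i 1)
    by_cases h : ∀ i, LinearMap.toMatrix' (A.toLinearMap ∘ₗ J ∘ₗ B.toLinearMap) *ᵥ x i = y i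
    · exact (if_pos h).trans (if_pos (hiff.1 h)).symm
    · exact (if_neg h).trans (if_neg (mt hiff.2 h)).symm
  | zero => exact ⟨0, by simp, by simp⟩
  | add f g _ _ hf hg =>
    obtain ⟨p, hpd, hp⟩ := hf
    obtain ⟨p', hpd', hp'⟩ := hg
    refine ⟨p + p', (natDegree_add_le _ _).trans (max_le hpd hpd'), fun J => ?_⟩
    simp only [Pi.add_apply, Finset.sum_add_distrib, eval_add, hp, hp']
  | smul c f _ hf =>
    obtain ⟨p, hpd, hp⟩ := hf
    refine ⟨C c * p, (natDegree_C_mul_le _ _).trans hpd, fun J => ?_⟩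
    simp only [Pi.smul_apply, smul_eq_mul, ← Finset.mul_sum, eval_mul, eval_C, hp]

/-- Weierstrass approximation of the ramp rising from `0` at `ε` to `1` at `1 - ε`. It replaces
amplification by repetition. -/
theorem exists_amplifying_polynomial {ε : ℝ} (hε : ε < 1 / 2) :
    ∃ g : ℝ[X], (∀ t ∈ Set.Icc (0 : ℝ) 1, -(1 / 20) ≤ g.eval t ∧ g.eval t ≤ 21 / 20) ∧
      (∀ t ∈ Set.Icc (0 : ℝ) 1, 1 - ε ≤ t → 19 / 20 ≤ g.eval t) ∧
      ∀ t ∈ Set.Icc (0 : ℝ) 1, t ≤ ε → g.eval t ≤ 1 / 20 := by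
  have hpos : 0 < 1 - 2 * ε := by linarith
  obtain ⟨g, hg⟩ := exists_polynomial_near_of_continuousOn 0 1
    (fun t => max 0 (min 1 ((t - ε) / (1 - 2 * ε)))) (by fun_prop) (1 / 20) (by norm_num)
  refine ⟨g, fun t ht => ?_, fun t ht hle => ?_, fun t ht hle => ?_⟩
  · have h := abs_lt.1 (hg t ht)
    have h0 := le_max_left 0 (min 1 ((t - ε) / (1 - 2 * ε)))
    have h1 : max 0 (min 1 ((t - ε) / (1 - 2 * ε))) ≤ 1 := max_le zero_le_one (min_le_left _ _)
    constructor <;> linarith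
  · have h := abs_lt.1 (hg t ht)
    have h1 : 1 ≤ (t - ε) / (1 - 2 * ε) := by rw [le_div_iff₀ hpos]; linarith
    rw [min_eq_left h1, max_eq_right zero_le_one] at h
    linarith
  · have h := abs_lt.1 (hg t ht)
    have h1 : (t - ε) / (1 - 2 * ε) ≤ 0 := div_nonpos_of_nonpos_of_nonneg (by linarith) hpos.le
    rw [min_eq_right (h1.trans zero_le_one), max_eq_left h1] at h
    linarith

theorem MVAlgorithm.Decides.min_le_mul_queries {ε : ℝ} {g : ℝ[X]}
    (hg : ∀ t ∈ Set.Icc (0 : ℝ) 1, -(1 / 20) ≤ g.eval t ∧ g.eval t ≤ 21 / 20)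
    (hg1 : ∀ t ∈ Set.Icc (0 : ℝ) 1, 1 - ε ≤ t → 19 / 20 ≤ g.eval t)
    (hg0 : ∀ t ∈ Set.Icc (0 : ℝ) 1, t ≤ ε → g.eval t ≤ 1 / 20)
    {yes no : Matrix (Fin m) (Fin n) F → Prop} (hyes : ∀ M, M.rank = min m n → yes M)
    (hno : ∀ M, M.rank + 1 = min m n → no M) {A : MVAlgorithm F m n} (hA : A.Decides ε yes no) :
    min m n ≤ g.natDegree * (A.queries + A.queries) := by
  classical
  rcases Nat.eq_zero_or_pos (min m n) with h0 | hN
  · simp [h0]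
  set N := min m n with hNdef
  let _ : Fintype ((Fin n → F) ≃ₗ[F] (Fin n → F)) :=
    have := Finite.of_injective _ (DFunLike.coe_injective (F := (Fin n → F) ≃ₗ[F] (Fin n → F)))
    Fintype.ofFinite _
  let _ : Fintype ((Fin m → F) ≃ₗ[F] (Fin m → F)) :=
    have := Finite.of_injective _ (DFunLike.coe_injective (F := (Fin m → F) ≃ₗ[F] (Fin m → F)))
    Fintype.ofFinite _
  let G := ((Fin n → F) ≃ₗ[F] (Fin n → F)) × ((Fin m → F) ≃ₗ[F] (Fin m → F))
  obtain ⟨p, hpd, hp⟩ := exists_polynomial_sum_of_mem_matVecSpan A.acceptProb_mem_matVecSpan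
  have hJ : ∀ j : ℕ, ∃ J : (Fin n → F) →ₗ[F] (Fin m → F), finrank F (LinearMap.range J) = N - j :=
    fun j => exists_linearMap_finrank_range_eq F (by omega) (by omega)
  choose J hJ using hJ
  let a : ℕ → G → ℝ := fun j b =>
    A.acceptProb (LinearMap.toMatrix' (b.2.toLinearMap ∘ₗ J j ∘ₗ b.1.toLinearMap))
  have hrank : ∀ j (b : G), (LinearMap.toMatrix'
      (b.2.toLinearMap ∘ₗ J j ∘ₗ b.1.toLinearMap)).rank = N - j :=
    fun j b => (rank_toMatrix'_comp _ _ _).trans (hJ j)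
  let avg : ℕ → ℝ := fun j => (Fintype.card G : ℝ)⁻¹ * ∑ b, a j b
  have hG : (0 : ℝ) < Fintype.card G := by exact_mod_cast Fintype.card_pos
  have havg_le : ∀ j c, (∀ b, a j b ≤ c) → avg j ≤ c := fun j c h => by
    rw [inv_mul_le_iff₀ hG]
    simpa using Finset.sum_le_card_nsmul Finset.univ (a j) c fun b _ => h b
  have hle_avg : ∀ j c, (∀ b, c ≤ a j b) → c ≤ avg j := fun j c h => by
    rw [le_inv_mul_iff₀ hG]
    simpa using Finset.card_nsmul_le_sum Finset.univ (a j) c fun b _ => h b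
  have hmem : ∀ j, avg j ∈ Set.Icc (0 : ℝ) 1 := fun j =>
    ⟨hle_avg j 0 fun b => A.acceptProb_nonneg _, havg_le j 1 fun b => A.acceptProb_le_one _⟩
  -- The inner substitution sends `q ^ j` to `q ^ (n - N + j)`, the kernel size at rank `N - j`; `g`
  -- is applied after averaging.
  let h : ℂ[X] := (g.map Complex.ofRealHom).comp
    ((C ((Fintype.card G : ℂ)⁻¹) * p).comp (C ((Fintype.card F : ℂ) ^ (n - N)) * X))
  have hdeg : h.natDegree ≤ g.natDegree * (A.queries + A.queries) := by
    refine natDegree_comp_le.trans (Nat.mul_le_mul (natDegree_map_le) ?_)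
    refine natDegree_comp_le.trans ?_
    refine (Nat.mul_le_mul ((natDegree_C_mul_le _ _).trans hpd)
      ((natDegree_C_mul_le _ _).trans natDegree_X_le)).trans (mul_one _).le
  refine le_trans ?_ hdeg
  have hq : (2 : ℝ) ≤ Fintype.card F := by exact_mod_cast Fintype.one_lt_card
  refine le_natDegree_of_geometric_jump hq hN (v := fun j => g.eval (avg j)) (fun j hj => ?_)
    (fun j _ => (hg _ (hmem j)).1) (fun j _ => (hg _ (hmem j)).2)
    (hg1 _ (hmem 0) (hle_avg 0 _ fun b => hA.1 _ (hyes _ ?_)))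
    (hg0 _ (hmem 1) (havg_le 1 _ fun b => hA.2 _ (hno _ ?_)))
  · have hker : finrank F (LinearMap.ker (J j)) = (n - N) + j := by
      have := (J j).finrank_range_add_finrank_ker
      rw [finrank_fin_fun, hJ] at this
      omega
    have key := hp (J j)
    rw [hker, pow_add] at key
    have hinner : ((C ((Fintype.card G : ℂ)⁻¹) * p).comp
        (C ((Fintype.card F : ℂ) ^ (n - N)) * X)).eval ((Fintype.card F : ℂ) ^ j) = avg j := by
      rw [eval_comp, eval_mul, eval_mul, eval_C, eval_C, eval_X, ← key, ← Fintype.sum_prod_type'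
        (f := fun (B : (Fin n → F) ≃ₗ[F] (Fin n → F)) (A' : (Fin m → F) ≃ₗ[F] (Fin m → F)) =>
          (A.acceptProb (LinearMap.toMatrix' (A'.toLinearMap ∘ₗ J j ∘ₗ B.toLinearMap)) : ℂ))]
      simp only [avg, a, G]
      push_cast
      rfl
    simp only [h, Complex.ofReal_natCast]
    rw [eval_comp, hinner]
    exact (eval_map_apply Complex.ofRealHom (avg j))
  · rw [hrank, Nat.sub_zero]
  · rw [hrank]; omega

theorem ofReal_le_mvQueryComplexity {ε c : ℝ} {yes no : Matrix (Fin m) (Fin n) F → Prop} {N : ℕ}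
    (h : ∀ A : MVAlgorithm F m n, A.Decides ε yes no → c * N ≤ A.queries) :
    ENNReal.ofReal (c * N) ≤ (mvQueryComplexity ε yes no : ENNReal) := by
  have hle : ((⌈c * N⌉₊ : ℕ) : ℕ∞) ≤ mvQueryComplexity ε yes no :=
    le_iInf₂ fun A hA => Nat.cast_le.2 (Nat.ceil_le.2 (h A hA))
  refine le_trans ?_ (ENat.toENNReal_mono hle)
  rw [ENat.toENNReal_coe, ← ENNReal.ofReal_natCast]
  exact ENNReal.ofReal_le_ofReal (Nat.le_ceil _)

end RankLowerBound

theorem mainTheorem5 (ε : ℝ) (hε₀ : 0 ≤ ε) (hε : ε < 1 / 2) :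
    ∃ c : ℝ, 0 < c ∧
      ∀ (F : Type*) [Field F] [Fintype F] [DecidableEq F] (m n : ℕ),
        ENNReal.ofReal (c * (min m n : ℕ)) ≤
            (mvQueryComplexity ε
              (fun M : Matrix (Fin m) (Fin n) F => IsFullRank M)
              (fun M => ¬ IsFullRank M) : ENNReal) ∧
        ENNReal.ofReal (c * (min m n : ℕ)) ≤
            (mvQueryComplexity ε
              (fun M : Matrix (Fin m) (Fin n) F => IsFullRank M)
              (fun M => matNullity M = 1) : ENNReal) := by
  obtain ⟨g, hg, hg1, hg0⟩ := exists_amplifying_polynomial hε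
  -- The `+ 1` avoids inverting zero in case `g.natDegree = 0`.
  refine ⟨(2 * (g.natDegree + 1))⁻¹, by positivity, fun F _ _ _ m n => ?_⟩
  have key : ∀ no : Matrix (Fin m) (Fin n) F → Prop, (∀ M, M.rank + 1 = min m n → no M) →
      ENNReal.ofReal ((2 * (g.natDegree + 1) : ℝ)⁻¹ * (min m n : ℕ)) ≤
        (mvQueryComplexity ε (fun M : Matrix (Fin m) (Fin n) F => IsFullRank M) no : ENNReal) := by
    intro no hno
    refine ofReal_le_mvQueryComplexity fun A hA => ?_
    have h := MVAlgorithm.Decides.min_le_mul_queries hg hg1 hg0 (fun M hM => hM) hno hA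
    have h' : ((min m n : ℕ) : ℝ) ≤ g.natDegree * (A.queries + A.queries) := by exact_mod_cast h
    rw [inv_mul_le_iff₀ (by positivity)]
    have : (0 : ℝ) ≤ A.queries := by positivity
    linarith
  refine ⟨key _ fun M hM hfull => ?_, key _ fun M hM => ?_⟩
  · rw [IsFullRank] at hfull
    omega
  · have := matNullity_add_rank M
    omega
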